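/- Let $(X_i)_{i\in I}$ be a family of compacta (compact Hausdorff spaces) and let $\mathcal U$ be an ultrafilter on the index set $I$. Let $\sum_{\mathcal U}X_i$ be the ultracoproduct of the $X_i$, that is, the (Gelfand) spectrum of the C*-algebra ultraproduct $\prod_{\mathcal U}C(X_i)=\{(f_i)\in\prod_i C(X_i,\mathbb C):\sup_i\|f_i\|<\infty\}/\{(f_i):\lim_{\mathcal U}\|f_i\|=0\}$. For a topological space $X$ let $\check H^1(X)$ be its first integral Čech cohomology group, i.e. the direct limit, over all open covers of $X$ ordered by refinement, of the first integral cohomology groups of the nerves of the covers. For abelian groups $G_i$ let $\prod_{\mathcal U}G_i$ be their ultraproduct, i.e. $\prod_i G_i$ modulo the subgroup $\{g : \{i : g_i=0\}\in\mathcal U\}$. Then $\prod_{\mathcal U}\check H^1(X_i)$ is a quotient of the group $\check H^1\left(\sum_{\mathcal U}X_i\right)$; that is, there is a surjective group homomorphism \[\check H^1\Big(\sum_{\mathcal U}X_i\Big)\longrightarrow\prod_{\mathcal U}\check H^1(X_i).\] -/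

import Mathlib

open TopologicalSpace Filter

/-! ### First integral Čech cohomology -/

namespace Cech

/-- An open cover of `X`, given as a set of open subsets. -/
structure OpenCover (X : Type*) [TopologicalSpace X] where
  /-- the members of the cover -/
  sets : Set (Opens X)
  covers : ∀ x : X, ∃ U ∈ sets, x ∈ U

section Nerve

variable {X : Type*} [TopologicalSpace X]

/-- The order by refinement: `𝒰 ≤ 𝒱` when `𝒱` refines `𝒰`. -/
instance : Preorder (OpenCover X) where
  le 𝒰 𝒱 := ∀ V ∈ 𝒱.sets, ∃ U ∈ 𝒰.sets, V ≤ U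
  le_refl _ V hV := ⟨V, hV, le_rfl⟩
  le_trans _ _ _ h₁ h₂ W hW := by
    obtain ⟨V, hV, hWV⟩ := h₂ W hW
    obtain ⟨U, hU, hVU⟩ := h₁ V hV
    exact ⟨U, hU, hWV.trans hVU⟩

/-- The ordered `n`-simplices of the nerve of `𝒰`: tuples `(U₀, …, Uₙ)` of members of `𝒰`
(repetitions allowed) with `U₀ ∩ ⋯ ∩ Uₙ` nonempty. -/
@[ext]
structure NerveSimplex (𝒰 : OpenCover X) (n : ℕ) where
  /-- the vertices of the simplex -/
  vertex : Fin (n + 1) → 𝒰.sets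
  nonempty : ∃ x : X, ∀ i, x ∈ (vertex i).1

/-- The `i`-th face of a simplex, omitting the `i`-th vertex. -/
def NerveSimplex.face {𝒰 : OpenCover X} {n : ℕ} (σ : NerveSimplex 𝒰 (n + 1)) (i : Fin (n + 2)) :
    NerveSimplex 𝒰 n :=
  ⟨fun j => σ.vertex (i.succAbove j), σ.nonempty.imp fun _ h j => h (i.succAbove j)⟩

/-- The integral `n`-cochains of the nerve of `𝒰`. -/
abbrev Cochain (𝒰 : OpenCover X) (n : ℕ) : Type _ := NerveSimplex 𝒰 n → ℤ

/-- The coboundary `δ : C⁰ → C¹`, `(δ f)(U₀, U₁) = f(U₁) - f(U₀)`. -/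
def coboundary₀ (𝒰 : OpenCover X) : Cochain 𝒰 0 →+ Cochain 𝒰 1 where
  toFun f σ := f (σ.face 0) - f (σ.face 1)
  map_zero' := by ext; simp
  map_add' f g := by ext; simp only [Pi.add_apply]; ring

/-- The coboundary `δ : C¹ → C²`, `(δ c)(U₀, U₁, U₂) = c(U₁, U₂) - c(U₀, U₂) + c(U₀, U₁)`. -/
def coboundary₁ (𝒰 : OpenCover X) : Cochain 𝒰 1 →+ Cochain 𝒰 2 where
  toFun c σ := c (σ.face 0) - c (σ.face 1) + c (σ.face 2)
  map_zero' := by ext; simp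
  map_add' f g := by ext; simp only [Pi.add_apply]; ring

/-- `H¹` of the nerve of `𝒰` with integer coefficients: 1-cocycles modulo 1-coboundaries. -/
abbrev NerveH1 (𝒰 : OpenCover X) : Type _ :=
  (coboundary₁ 𝒰).ker ⧸ (coboundary₀ 𝒰).range.addSubgroupOf (coboundary₁ 𝒰).ker

/-- `r` is a refinement projection from `𝒱` to `𝒰`: `V ⊆ r V` for all `V ∈ 𝒱`. -/
def IsProjection {𝒰 𝒱 : OpenCover X} (r : 𝒱.sets → 𝒰.sets) : Prop := ∀ V, V.1 ≤ (r V).1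

/-- The simplicial map of nerves induced by a refinement projection. -/
def NerveSimplex.map {𝒰 𝒱 : OpenCover X} {r : 𝒱.sets → 𝒰.sets} (hr : IsProjection r) {n : ℕ}
    (σ : NerveSimplex 𝒱 n) : NerveSimplex 𝒰 n :=
  ⟨fun i => r (σ.vertex i), σ.nonempty.imp fun _ h i => hr _ (h i)⟩

/-- Pullback of cochains along a refinement projection. -/
def pullback {𝒰 𝒱 : OpenCover X} {r : 𝒱.sets → 𝒰.sets} (hr : IsProjection r) (n : ℕ) :
    Cochain 𝒰 n →+ Cochain 𝒱 n where
  toFun c σ := c (σ.map hr)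
  map_zero' := rfl
  map_add' _ _ := rfl

theorem pullback_coboundary₀ {𝒰 𝒱 : OpenCover X} {r : 𝒱.sets → 𝒰.sets} (hr : IsProjection r)
    (f : Cochain 𝒰 0) :
    pullback hr 1 (coboundary₀ 𝒰 f) = coboundary₀ 𝒱 (pullback hr 0 f) := rfl

theorem pullback_coboundary₁ {𝒰 𝒱 : OpenCover X} {r : 𝒱.sets → 𝒰.sets} (hr : IsProjection r)
    (c : Cochain 𝒰 1) :
    pullback hr 2 (coboundary₁ 𝒰 c) = coboundary₁ 𝒱 (pullback hr 1 c) := rfl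

/-- Pullback of cocycles along a refinement projection. -/
def pullbackCocycle {𝒰 𝒱 : OpenCover X} {r : 𝒱.sets → 𝒰.sets} (hr : IsProjection r) :
    (coboundary₁ 𝒰).ker →+ (coboundary₁ 𝒱).ker :=
  ((pullback hr 1).comp (coboundary₁ 𝒰).ker.subtype).codRestrict _ fun c => by
    have hc : coboundary₁ 𝒰 c.1 = 0 := c.2
    change coboundary₁ 𝒱 (pullback hr 1 c.1) = 0
    rw [← pullback_coboundary₁, hc, map_zero]

/-- The map on `H¹` of nerves induced by a refinement projection. -/
def mapOfProjection {𝒰 𝒱 : OpenCover X} {r : 𝒱.sets → 𝒰.sets} (hr : IsProjection r) :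
    NerveH1 𝒰 →+ NerveH1 𝒱 :=
  QuotientAddGroup.map _ _ (pullbackCocycle hr) (by
    rintro c ⟨f, hf⟩
    refine ⟨pullback hr 0 f, ?_⟩
    rw [← pullback_coboundary₀, hf]
    rfl)

/-- The map on `H¹` does not depend on the refinement projection. -/
theorem mapOfProjection_eq {𝒰 𝒱 : OpenCover X} {r s : 𝒱.sets → 𝒰.sets} (hr : IsProjection r)
    (hs : IsProjection s) : mapOfProjection hr = mapOfProjection hs := by
  ext c
  refine (QuotientAddGroup.eq).2 ?_
  -- the prism homotopy `f(V) = c(r V, s V)`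
  refine ⟨fun σ => c.1 ⟨![r (σ.vertex 0), s (σ.vertex 0)], σ.nonempty.imp fun x h i => ?_⟩, ?_⟩
  · fin_cases i
    · exact hr _ (h 0)
    · exact hs _ (h 0)
  · have hc : coboundary₁ 𝒰 c.1 = 0 := c.2
    funext σ
    obtain ⟨x, hx⟩ := σ.nonempty
    have h₁ := congrFun hc ⟨![r (σ.vertex 0), s (σ.vertex 0), s (σ.vertex 1)], x, fun i => by
      fin_cases i
      · exact hr _ (hx 0)
      · exact hs _ (hx 0)
      · exact hs _ (hx 1)⟩
    have h₂ := congrFun hc ⟨![r (σ.vertex 0), r (σ.vertex 1), s (σ.vertex 1)], x, fun i => by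
      fin_cases i
      · exact hr _ (hx 0)
      · exact hr _ (hx 1)
      · exact hs _ (hx 1)⟩
    have e : ∀ (a b : NerveSimplex 𝒰 1), a.vertex 0 = b.vertex 0 → a.vertex 1 = b.vertex 1 → c.1 a = c.1 b := by
      intro a b h0 h1
      have hab : a = b := by
        apply NerveSimplex.ext
        funext i
        fin_cases i
        · exact h0
        · exact h1
      rw [hab]
    change c.1 _ - c.1 _ + c.1 _ = 0 at h₁ h₂
    change c.1 _ - c.1 _ = -(c.1 _) + c.1 _
    have A : ∀ {a₁ a₂ a₃ b₁ b₂ b₃ p q u v : NerveSimplex 𝒰 1},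
        c.1 a₁ - c.1 a₂ + c.1 a₃ = 0 → c.1 b₁ - c.1 b₂ + c.1 b₃ = 0 →
        c.1 a₁ = c.1 v → c.1 a₂ = c.1 b₂ → c.1 a₃ = c.1 q → c.1 b₁ = c.1 p → c.1 b₃ = c.1 u →
        c.1 p - c.1 q = -(c.1 u) + c.1 v := by
      intros; linarith
    exact A h₁ h₂ (e _ _ rfl rfl) (e _ _ rfl rfl) (e _ _ rfl rfl) (e _ _ rfl rfl) (e _ _ rfl rfl)

/-- The canonical map `H¹(𝒰) → H¹(𝒱)` when `𝒱` refines `𝒰`. -/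
noncomputable def transition (𝒰 𝒱 : OpenCover X) (h : 𝒰 ≤ 𝒱) : NerveH1 𝒰 →+ NerveH1 𝒱 :=
  mapOfProjection (r := fun V => ⟨(h V.1 V.2).choose, (h V.1 V.2).choose_spec.1⟩)
    (fun V => (h V.1 V.2).choose_spec.2)

theorem transition_eq {𝒰 𝒱 : OpenCover X} (h : 𝒰 ≤ 𝒱) {r : 𝒱.sets → 𝒰.sets} (hr : IsProjection r) :
    transition 𝒰 𝒱 h = mapOfProjection hr := mapOfProjection_eq _ _

instance : DirectedSystem (fun 𝒰 : OpenCover X => NerveH1 𝒰) (fun 𝒰 𝒱 h => transition 𝒰 𝒱 h) where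
  map_self 𝒰 c := by
    rw [transition_eq _ (r := id) (fun _ => le_rfl)]
    induction c using QuotientAddGroup.induction_on
    rfl
  map_map 𝒲 𝒱 𝒰 h₁ h₂ c := by
    obtain ⟨r, hr⟩ : ∃ r : 𝒱.sets → 𝒰.sets, IsProjection r :=
      ⟨fun V => ⟨(h₁ V.1 V.2).choose, (h₁ V.1 V.2).choose_spec.1⟩,
        fun V => (h₁ V.1 V.2).choose_spec.2⟩
    obtain ⟨s, hs⟩ : ∃ s : 𝒲.1 → 𝒱.sets, IsProjection s :=
      ⟨fun V => ⟨(h₂ V.1 V.2).choose, (h₂ V.1 V.2).choose_spec.1⟩,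
        fun V => (h₂ V.1 V.2).choose_spec.2⟩
    have hrs : IsProjection (fun W => r (s W)) := fun W => (hs W).trans (hr (s W))
    rw [transition_eq h₁ hr, transition_eq h₂ hs, transition_eq (h₁.trans h₂) hrs]
    induction c using QuotientAddGroup.induction_on
    rfl

end Nerve

open scoped Classical in
/-- The first integral Čech cohomology group of `X`: the direct limit, over all open covers of `X`
directed by refinement, of the first integral cohomology groups of the nerves. -/
def CechH1 (X : Type*) [TopologicalSpace X] : Type _ :=
  AddCommGroup.DirectLimit (fun 𝒰 : OpenCover X => NerveH1 𝒰) (fun 𝒰 𝒱 h => transition 𝒰 𝒱 h)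

open scoped Classical in
noncomputable instance (X : Type*) [TopologicalSpace X] : AddCommGroup (CechH1 X) :=
  inferInstanceAs (AddCommGroup (AddCommGroup.DirectLimit
    (fun 𝒰 : OpenCover X => NerveH1 𝒰) (fun 𝒰 𝒱 h => transition 𝒰 𝒱 h)))

end Cech

/-! ### Ultraproducts of abelian groups -/

section GroupUltraproduct

variable {I : Type*} (𝓤 : Ultrafilter I) (G : I → Type*) [∀ i, AddCommGroup (G i)]

/-- The families that vanish for `𝓤`-almost every index. -/
def eventuallyZero : AddSubgroup (∀ i, G i) where
  carrier := {g | ∀ᶠ i in (𝓤 : Filter I), g i = 0}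
  zero_mem' := Eventually.of_forall fun _ => rfl
  add_mem' {g h} hg hh := by
    filter_upwards [hg, hh] with i h₁ h₂
    simp [h₁, h₂]
  neg_mem' {g} hg := by
    filter_upwards [hg] with i h₁
    simp [h₁]

/-- The ultraproduct of the abelian groups `G i`: families modulo equality `𝓤`-almost
everywhere. -/
def GroupUltraproduct : Type _ := (∀ i, G i) ⧸ eventuallyZero 𝓤 G

instance : AddCommGroup (GroupUltraproduct 𝓤 G) :=
  inferInstanceAs (AddCommGroup ((∀ i, G i) ⧸ eventuallyZero 𝓤 G))

end GroupUltraproduct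

/-! ### Ultraproducts of the algebras `C(X i)` and ultracoproducts of compacta -/

section Ultracoproduct

variable {I : Type*} (𝓤 : Ultrafilter I) (X : I → Type*) [∀ i, TopologicalSpace (X i)]
  [∀ i, CompactSpace (X i)]

/-- The `ℓ^∞`-product of the C*-algebras `C(X i)`: uniformly norm-bounded families. -/
noncomputable def boundedFamilies : Subalgebra ℂ (∀ i, C(X i, ℂ)) where
  carrier := {f | ∃ K : ℝ, ∀ i, ‖f i‖ ≤ K}
  mul_mem' := by
    rintro f g ⟨K, hK⟩ ⟨L, hL⟩
    exact ⟨K * L, fun i => (norm_mul_le _ _).trans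
      (mul_le_mul (hK i) (hL i) (norm_nonneg _) ((norm_nonneg _).trans (hK i)))⟩
  add_mem' := by
    rintro f g ⟨K, hK⟩ ⟨L, hL⟩
    exact ⟨K + L, fun i => (norm_add_le _ _).trans (add_le_add (hK i) (hL i))⟩
  algebraMap_mem' z := ⟨‖z‖, fun i => (ContinuousMap.norm_le _ (norm_nonneg z)).2 fun x => by simp⟩

/-- The ideal of bounded families whose norm tends to `0` along `𝓤`. -/
noncomputable def nullFamilies : Ideal (boundedFamilies X) where
  carrier := {f | Tendsto (fun i => ‖f.1 i‖) (𝓤 : Filter I) (nhds 0)}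
  zero_mem' := by simp
  add_mem' {f g} hf hg :=
    squeeze_zero (fun _ => norm_nonneg _) (fun i => norm_add_le (f.1 i) (g.1 i))
      (by simpa using Tendsto.add hf hg)
  smul_mem' := by
    rintro ⟨f, K, hK⟩ g hg
    refine squeeze_zero (fun _ => norm_nonneg _) (fun i => ?_)
      (by simpa using Tendsto.const_mul K hg)
    exact (norm_mul_le (f i) (g.1 i)).trans
      (mul_le_mul_of_nonneg_right (hK i) (norm_nonneg _))

/-- The C*-algebra ultraproduct of the `C(X i)`, as a unital commutative complex algebra. (Its
norm, `lim_𝓤 ‖f i‖`, is not needed for the spectrum, since unital characters of a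
unital C*-algebra are automatically continuous.) -/
abbrev FunctionUltraproduct : Type _ := boundedFamilies X ⧸ nullFamilies 𝓤 X

/-- The ultracoproduct of the compacta `X i`: the (Gelfand) spectrum of the C*-algebra
ultraproduct of the `C(X i)`, i.e. the set of its unital characters. -/
def Ultracoproduct : Type _ := FunctionUltraproduct 𝓤 X →ₐ[ℂ] ℂ

/-- The spectrum carries the weak-* topology, that of pointwise convergence of characters. -/
noncomputable instance : TopologicalSpace (Ultracoproduct 𝓤 X) :=
  TopologicalSpace.induced
    (fun φ : FunctionUltraproduct 𝓤 X →ₐ[ℂ] ℂ => (φ : FunctionUltraproduct 𝓤 X → ℂ))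
    inferInstance

end Ultracoproduct

/-!
The proof describes first Čech cohomology by circle-valued functions. On an open cover a continuous
`f : X → Circle` may have local real logarithms; on overlaps they differ by integral multiples of
`2π`, and these integers form a Čech cocycle. The relation `Cech.Represents f ξ` says that `ξ` is
the class of such a cocycle. It respects quotients (`Represents.div`), every `f` represents a class
(`exists_represents`), every class of a compactum is represented (`exists_represents_class`, by a
partition of unity), and `f` represents `0` exactly when it has a global logarithm
(`Represents.exists_eq_exp`, `Represents.eq_zero`). So `Ȟ¹(X)` is `C(X, Circle)` modulo
exponentials of real functions. The point of this description is that the circle is compact,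
whereas integral cocycles and the sizes of covers need not be bounded along the index set.

Let `Z` be the Stone–Čech compactification of the disjoint union of the `X i`. It maps to the space
of ultrafilters on the index set, and Gelfand duality for `C(Z, ℂ)`, which is the algebra of bounded
families, identifies the ultracoproduct with the fibre over `𝓤` (`fiberCharacter_bijective`).
Arbitrary families of maps `X i → Circle` extend to `Z` by the universal property, and
circle-valued functions on the ultracoproduct extend to `Z` by Tietze's theorem and normalization
near the fibre (`exists_circle_extension`).

The homomorphism has as its graph the pairs `(ξ, [η i])` for which a single `G : Z → Circle`
represents `ξ` on the ultracoproduct and every `η i` on `X i`. The extension results make this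
relation total in both variables. It is single-valued because a global logarithm of `G` on the
ultracoproduct extends to `Z`, and its exponential stays close to `G` on almost all `X i`
(`eventually_eq_zero_of_represents`).
-/

/-! ### Homomorphisms from additive relations -/

/-- A relation between abelian groups that is closed under subtraction, total in both variables and
relates `0` only to `0` is the graph of a surjective homomorphism. -/
theorem exists_surjective_addMonoidHom_of_relation {A B : Type*} [AddCommGroup A] [AddCommGroup B]
    (R : A → B → Prop) (hsub : ∀ {a a' b b'}, R a b → R a' b' → R (a - a') (b - b'))
    (hleft : ∀ a, ∃ b, R a b) (hright : ∀ b, ∃ a, R a b) (hzero : ∀ b, R 0 b → b = 0) :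
    ∃ q : A →+ B, Function.Surjective q := by
  have huniq : ∀ {a b b'}, R a b → R a b' → b = b' := fun {a b b'} h h' =>
    sub_eq_zero.1 (hzero _ (by simpa using hsub h h'))
  have h00 : R 0 0 := by
    obtain ⟨b, hb⟩ := hleft 0
    simpa using hsub hb hb
  have hadd : ∀ {a a' b b'}, R a b → R a' b' → R (a + a') (b + b') := fun h h' => by
    simpa using hsub h (hsub h00 h')
  choose q hq using hleft
  refine ⟨AddMonoidHom.mk' q fun a a' => huniq (hq _) (hadd (hq a) (hq a')), fun b => ?_⟩
  obtain ⟨a, ha⟩ := hright b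
  exact ⟨a, huniq (hq a) ha⟩

namespace Cech

variable {X : Type*} [TopologicalSpace X]

/-! ### Čech classes of cocycles -/

instance : Nonempty (OpenCover X) := ⟨⟨{⊤}, fun _ => ⟨⊤, rfl, trivial⟩⟩⟩

/-- Any two open covers have a common refinement, given by pairwise intersections. -/
instance : IsDirectedOrder (OpenCover X) where
  directed 𝒰 𝒱 := by
    refine ⟨⟨{W | ∃ U ∈ 𝒰.sets, ∃ V ∈ 𝒱.sets, W = U ⊓ V}, fun x => ?_⟩, ?_, ?_⟩
    · obtain ⟨U, hU, hxU⟩ := 𝒰.covers x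
      obtain ⟨V, hV, hxV⟩ := 𝒱.covers x
      exact ⟨U ⊓ V, ⟨U, hU, V, hV, rfl⟩, hxU, hxV⟩
    · rintro _ ⟨U, hU, V, hV, rfl⟩
      exact ⟨U, hU, inf_le_left⟩
    · rintro _ ⟨U, hU, V, hV, rfl⟩
      exact ⟨V, hV, inf_le_right⟩

theorem exists_isProjection {𝒰 𝒱 : OpenCover X} (h : 𝒰 ≤ 𝒱) :
    ∃ r : 𝒱.sets → 𝒰.sets, IsProjection r :=
  ⟨fun V => ⟨(h V.1 V.2).choose, (h V.1 V.2).choose_spec.1⟩,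
    fun V => (h V.1 V.2).choose_spec.2⟩

open scoped Classical in
/-- The class in the first Čech cohomology group of a 1-cocycle on the nerve of `𝒰`. -/
noncomputable def cechClass (𝒰 : OpenCover X) : (coboundary₁ 𝒰).ker →+ CechH1 X :=
  (AddCommGroup.DirectLimit.of (fun 𝒰 : OpenCover X => NerveH1 𝒰)
    (fun 𝒰 𝒱 h => transition 𝒰 𝒱 h) 𝒰).comp (QuotientAddGroup.mk' _)

theorem cechClass_pullbackCocycle {𝒰 𝒱 : OpenCover X} {r : 𝒱.sets → 𝒰.sets} (hr : IsProjection r)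
    (c : (coboundary₁ 𝒰).ker) : cechClass 𝒱 (pullbackCocycle hr c) = cechClass 𝒰 c := by
  classical
  have h : 𝒰 ≤ 𝒱 := fun V hV => ⟨(r ⟨V, hV⟩).1, (r ⟨V, hV⟩).2, hr ⟨V, hV⟩⟩
  have e := AddCommGroup.DirectLimit.of_f (G := fun 𝒰 : OpenCover X => NerveH1 𝒰)
    (f := fun 𝒰 𝒱 h => transition 𝒰 𝒱 h) h (QuotientAddGroup.mk' _ c)
  rw [transition_eq h hr] at e
  exact e

theorem exists_cechClass_eq (ξ : CechH1 X) : ∃ 𝒰 c, cechClass 𝒰 c = ξ := by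
  classical
  refine AddCommGroup.DirectLimit.induction_on (G := fun 𝒰 : OpenCover X => NerveH1 𝒰)
    (f := fun 𝒰 𝒱 h => transition 𝒰 𝒱 h)
    (C := fun ξ => ∃ 𝒰 c, cechClass 𝒰 c = ξ) ξ fun 𝒰 x => ?_
  obtain ⟨c, rfl⟩ := QuotientAddGroup.mk'_surjective _ x
  exact ⟨𝒰, c, by unfold cechClass; rfl⟩

theorem cechClass_eq_zero_of_coboundary {𝒰 : OpenCover X} {c : (coboundary₁ 𝒰).ker}
    (g : 𝒰.sets → ℤ) (hg : ∀ σ, c.1 σ = g (σ.vertex 1) - g (σ.vertex 0)) :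
    cechClass 𝒰 c = 0 := by
  classical
  have : QuotientAddGroup.mk' ((coboundary₀ 𝒰).range.addSubgroupOf (coboundary₁ 𝒰).ker) c = 0 :=
    (QuotientAddGroup.eq_zero_iff _).2 ⟨fun σ => g (σ.vertex 0), funext fun σ => (hg σ).symm⟩
  exact (congrArg (AddCommGroup.DirectLimit.of (fun 𝒰 : OpenCover X => NerveH1 𝒰)
    (fun 𝒰 𝒱 h => transition 𝒰 𝒱 h) 𝒰) this).trans (map_zero _)

/-- A cocycle with vanishing Čech class becomes a coboundary on some refinement. -/
theorem exists_coboundary_of_cechClass_eq_zero {𝒰 : OpenCover X} {c : (coboundary₁ 𝒰).ker}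
    (hc : cechClass 𝒰 c = 0) :
    ∃ (𝒱 : OpenCover X) (r : 𝒱.sets → 𝒰.sets) (hr : IsProjection r) (g : 𝒱.sets → ℤ),
      ∀ σ : NerveSimplex 𝒱 1, c.1 (σ.map hr) = g (σ.vertex 1) - g (σ.vertex 0) := by
  classical
  obtain ⟨𝒱, h, h0⟩ := AddCommGroup.DirectLimit.of.zero_exact
    (G := fun 𝒰 : OpenCover X => NerveH1 𝒰) (f := fun 𝒰 𝒱 h => transition 𝒰 𝒱 h) 𝒰
    (QuotientAddGroup.mk' _ c) hc
  obtain ⟨r, hr⟩ := exists_isProjection h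
  rw [transition_eq h hr] at h0
  obtain ⟨f, hf⟩ := (QuotientAddGroup.eq_zero_iff (pullbackCocycle hr c)).1 h0
  refine ⟨𝒱, r, hr, fun V => if hV : ∃ x : X, x ∈ V.1 then f ⟨fun _ => V, hV.imp fun _ h _ => h⟩
    else 0, fun σ => ?_⟩
  obtain ⟨x, hx⟩ := σ.nonempty
  beta_reduce
  rw [dif_pos ⟨x, hx 1⟩, dif_pos ⟨x, hx 0⟩]
  have e : ∀ τ : NerveSimplex 𝒱 0, ∀ V h, τ.vertex 0 = V → f τ = f ⟨fun _ => V, h⟩ := by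
    rintro τ _ h rfl
    congr 1
    ext i
    rw [Subsingleton.elim (α := Fin 1) i 0]
  refine (congrFun hf σ).symm.trans ?_
  change f (σ.face 0) - f (σ.face 1) = _
  rw [e (σ.face 0) (σ.vertex 1) _ rfl, e (σ.face 1) (σ.vertex 0) _ rfl]

/-! ### Circle-valued functions and Čech classes -/

/-- `h` is a system of local logarithms on `𝒰` of the circle-valued function `f`, with monodromy
`c`: the function `h U` is a continuous logarithm of `f` on `U`, and on `U₀ ∩ U₁` the functions
`h U₁` and `h U₀` differ by `2π c(U₀, U₁)`. Outside `U` the values of `h U` are irrelevant. -/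
structure IsLogarithm {𝒰 : OpenCover X} (f : C(X, Circle)) (c : Cochain 𝒰 1)
    (h : 𝒰.sets → X → ℝ) : Prop where
  continuousOn : ∀ U, ContinuousOn (h U) U.1
  exp_eq : ∀ U, ∀ x ∈ U.1, Circle.exp (h U x) = f x
  sub_eq : ∀ (σ : NerveSimplex 𝒰 1) x, (∀ i, x ∈ (σ.vertex i).1) →
    h (σ.vertex 1) x - h (σ.vertex 0) x = c σ * (2 * Real.pi)

/-- The circle-valued function `f` represents the Čech class `ξ`: on some open cover `f` has local
logarithms whose integral monodromy cocycle has class `ξ`. -/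
def Represents (f : C(X, Circle)) (ξ : CechH1 X) : Prop :=
  ∃ (𝒰 : OpenCover X) (c : (coboundary₁ 𝒰).ker) (h : 𝒰.sets → X → ℝ),
    IsLogarithm f c.1 h ∧ cechClass 𝒰 c = ξ

theorem IsLogarithm.pullback {𝒰 𝒱 : OpenCover X} {f : C(X, Circle)} {c : Cochain 𝒰 1}
    {h : 𝒰.sets → X → ℝ} (H : IsLogarithm f c h) {r : 𝒱.sets → 𝒰.sets} (hr : IsProjection r) :
    IsLogarithm f (pullback hr 1 c) (fun V => h (r V)) where
  continuousOn V := (H.continuousOn (r V)).mono (hr V)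
  exp_eq V x hx := H.exp_eq (r V) x (hr V hx)
  sub_eq σ x hx := H.sub_eq (σ.map hr) x fun i => hr _ (hx i)

theorem Represents.div {f g : C(X, Circle)} {ξ η : CechH1 X} (hf : Represents f ξ)
    (hg : Represents g η) : Represents (f / g) (ξ - η) := by
  obtain ⟨𝒰, c, h, H, rfl⟩ := hf
  obtain ⟨𝒱, d, k, K, rfl⟩ := hg
  obtain ⟨𝒲, h₁, h₂⟩ := exists_ge_ge 𝒰 𝒱
  obtain ⟨r, hr⟩ := exists_isProjection h₁
  obtain ⟨s, hs⟩ := exists_isProjection h₂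
  have H' := H.pullback hr
  have K' := K.pullback hs
  refine ⟨𝒲, pullbackCocycle hr c - pullbackCocycle hs d, fun W x => h (r W) x - k (s W) x,
    ⟨fun W => (H'.continuousOn W).sub (K'.continuousOn W), fun W x hx => ?_, fun σ x hx => ?_⟩, ?_⟩
  · rw [Circle.exp_sub, H'.exp_eq W x hx, K'.exp_eq W x hx, ContinuousMap.div_apply]
  · have e₁ := H'.sub_eq σ x hx
    have e₂ := K'.sub_eq σ x hx
    change _ = ((pullback hr 1 c.1 σ - pullback hs 1 d.1 σ : ℤ) : ℝ) * _
    push_cast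
    linear_combination e₁ - e₂
  · rw [map_sub, cechClass_pullbackCocycle, cechClass_pullbackCocycle]

/-- A circle-valued function representing the zero class has a global logarithm: on a refinement
the local logarithms can be corrected by integer multiples of `2π` so that they agree. -/
theorem Represents.exists_eq_exp {f : C(X, Circle)} (hf : Represents f 0) :
    ∃ h : C(X, ℝ), f = Circle.exp.comp h := by
  obtain ⟨𝒰, c, h, H, hc⟩ := hf
  obtain ⟨𝒱, r, hr, g, hg⟩ := exists_coboundary_of_cechClass_eq_zero hc
  have H' := H.pullback hr
  choose V hV hxV using 𝒱.covers
  set k : 𝒱.sets → X → ℝ := fun W x => h (r W) x - g W * (2 * Real.pi) with hk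
  have glue : ∀ (W W' : 𝒱.sets) x, x ∈ W.1 → x ∈ W'.1 → k W x = k W' x := by
    intro W W' x hx hx'
    have hmem : ∀ i, x ∈ ((![W, W'] : Fin 2 → 𝒱.sets) i).1 := fun i => by
      fin_cases i
      exacts [hx, hx']
    have e := H'.sub_eq ⟨![W, W'], x, hmem⟩ x hmem
    have e' : pullback hr 1 c.1 ⟨![W, W'], x, hmem⟩ = g W' - g W := hg _
    rw [e'] at e
    simp only [Matrix.cons_val_zero, Matrix.cons_val_one] at e
    push_cast at e
    simp only [hk]
    linear_combination -e
  refine ⟨⟨fun x => k ⟨V x, hV x⟩ x, continuous_iff_continuousAt.2 fun x => ?_⟩, ?_⟩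
  · have h1 : ContinuousOn (k ⟨V x, hV x⟩) (V x) :=
      (H'.continuousOn ⟨V x, hV x⟩).sub continuousOn_const
    have hnhds := (V x).isOpen.mem_nhds (hxV x)
    refine (h1.continuousAt hnhds).congr ?_
    filter_upwards [hnhds] with y hy
    exact glue _ _ y hy (hxV y)
  · ext1 x
    change f x = Circle.exp (h (r ⟨V x, hV x⟩) x - g _ * (2 * Real.pi))
    rw [Circle.exp_sub, Circle.exp_int_mul_two_pi, div_one, H'.exp_eq ⟨V x, hV x⟩ x (hxV x)]

/-- A circle-valued function with a global logarithm represents only the zero class: the local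
logarithms differ from the global one by locally constant multiples of `2π`, so on the refinement
by their level sets the monodromy is a coboundary. -/
theorem Represents.eq_zero {h : C(X, ℝ)} {ξ : CechH1 X} (H : Represents (Circle.exp.comp h) ξ) :
    ξ = 0 := by
  obtain ⟨𝒰, c, k, K, rfl⟩ := H
  have hint : ∀ U : 𝒰.sets, ∀ x ∈ U.1, ∃ n : ℤ, k U x = h x + n * (2 * Real.pi) := by
    intro U x hx
    have e : Circle.exp (k U x - h x) = 1 := by
      rw [Circle.exp_sub, K.exp_eq U x hx]
      exact div_self' _
    obtain ⟨n, hn⟩ := Circle.exp_eq_one.1 e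
    exact ⟨n, by linarith⟩
  -- The level `n` is an open condition, in the form `|k - h - 2πn| < 2π`.
  let L : 𝒰.sets → ℤ → Opens X := fun U n =>
    ⟨U.1 ∩ (fun x => k U x - h x) ⁻¹' Metric.ball (n * (2 * Real.pi)) (2 * Real.pi),
      ((K.continuousOn U).sub h.continuous.continuousOn).isOpen_inter_preimage U.1.isOpen
        Metric.isOpen_ball⟩
  have hL : ∀ U n x, x ∈ L U n → k U x = h x + n * (2 * Real.pi) := by
    rintro U n x ⟨hx, hn⟩
    obtain ⟨m, hm⟩ := hint U x hx
    have hpi := Real.two_pi_pos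
    have e : |((m - n : ℤ) : ℝ)| * (2 * Real.pi) < 1 * (2 * Real.pi) := by
      rw [Set.mem_preimage, Metric.mem_ball, Real.dist_eq, hm] at hn
      rw [one_mul]
      convert hn using 1
      rw [← abs_of_pos hpi, ← abs_mul, abs_of_pos hpi]
      push_cast
      ring_nf
    have e' : |m - n| < 1 := by exact_mod_cast lt_of_mul_lt_mul_right e hpi.le
    rw [hm, sub_eq_zero.1 (Int.abs_lt_one_iff.1 e')]
  let 𝒱 : OpenCover X := ⟨{W | ∃ U n, W = L U n}, fun x => by
    obtain ⟨U, hU, hx⟩ := 𝒰.covers x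
    obtain ⟨n, hn⟩ := hint ⟨U, hU⟩ x hx
    exact ⟨L ⟨U, hU⟩ n, ⟨_, _, rfl⟩, hx, by simp [hn, Real.pi_pos]⟩⟩
  choose r n hrn using fun W : 𝒱.sets => W.2
  have hr : IsProjection r := fun W => by
    rw [hrn W]
    exact fun x hx => hx.1
  rw [← cechClass_pullbackCocycle hr c]
  refine cechClass_eq_zero_of_coboundary n fun σ => ?_
  obtain ⟨x, hx⟩ := σ.nonempty
  have key : ∀ i, k (r (σ.vertex i)) x = h x + n (σ.vertex i) * (2 * Real.pi) := fun i =>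
    hL _ _ x (by rw [← hrn]; exact hx i)
  have e := (K.pullback hr).sub_eq σ x hx
  rw [key 0, key 1] at e
  have e' : ((n (σ.vertex 1) - n (σ.vertex 0) : ℤ) : ℝ) * (2 * Real.pi)
      = (pullback hr 1 c.1 σ : ℤ) * (2 * Real.pi) := by
    push_cast
    linear_combination e
  exact_mod_cast (mul_right_cancel₀ Real.two_pi_pos.ne' e').symm

/-- The principal argument is a continuous logarithm away from `-1`. -/
theorem continuousAt_arg_circle {z : Circle} (hz : z ≠ -1) :
    ContinuousAt (fun w : Circle => Complex.arg w) z := by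
  refine (Complex.continuousAt_arg ?_).comp continuous_subtype_val.continuousAt
  refine Complex.mem_slitPlane_iff_arg.2 ⟨fun h => hz ?_, z.coe_ne_zero⟩
  rw [← Circle.exp_arg z, h]
  ext
  simp [Circle.coe_exp]

/-- Every circle-valued function represents a class. On the cover by preimages of open half
circles there are logarithms with values in intervals of length `π`, so that on an overlap the
difference of two of them is confined to an open interval of length `2π`, hence constant. -/
theorem exists_represents (f : C(X, Circle)) : ∃ ξ, Represents f ξ := by
  have hpi := Real.pi_pos
  let A : Circle → Opens X := fun z => ⟨{x | |Complex.arg (f x / z : Circle)| < Real.pi / 2}, by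
    rw [isOpen_iff_mem_nhds]
    intro x hx
    have hne : f x / z ≠ -1 := by
      rintro h
      rw [Set.mem_ofPred, h] at hx
      simp [abs_of_pos hpi] at hx
      linarith
    have hcont : ContinuousAt (fun y => |Complex.arg (f y / z : Circle)|) x :=
      ((continuousAt_arg_circle hne).comp (f := fun y => f y / z)
        (f.continuous.div_const z).continuousAt).abs
    exact hcont.eventually_lt continuousAt_const hx⟩
  let 𝒰 : OpenCover X := ⟨{W | ∃ z, W = A z}, fun x => ⟨A (f x), ⟨_, rfl⟩, by
    change |Complex.arg (f x / f x : Circle)| < _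
    simp [hpi]⟩⟩
  choose z hz using fun U : 𝒰.sets => U.2
  let h : 𝒰.sets → X → ℝ := fun U x => Complex.arg (z U) + Complex.arg (f x / z U : Circle)
  have hmem : ∀ (U : 𝒰.sets), ∀ x ∈ U.1, |Complex.arg (f x / z U : Circle)| < Real.pi / 2 := by
    intro U x hx
    rw [hz U] at hx
    exact hx
  have hexp : ∀ (U : 𝒰.sets) x, Circle.exp (h U x) = f x := fun U x => by
    rw [Circle.exp_add, Circle.exp_arg, Circle.exp_arg, mul_div_cancel]
  have hdiff : ∀ (U V : 𝒰.sets) x, ∃ n : ℤ, h V x - h U x = n * (2 * Real.pi) := fun U V x => by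
    apply Circle.exp_eq_one.1
    rw [Circle.exp_sub, hexp, hexp, div_self']
  let c : Cochain 𝒰 1 := fun σ =>
    (hdiff (σ.vertex 0) (σ.vertex 1) σ.nonempty.choose).choose
  have hc : ∀ (σ : NerveSimplex 𝒰 1) x, (∀ i, x ∈ (σ.vertex i).1) →
      h (σ.vertex 1) x - h (σ.vertex 0) x = c σ * (2 * Real.pi) := by
    intro σ x hx
    obtain ⟨n, hn⟩ := hdiff (σ.vertex 0) (σ.vertex 1) x
    have hy := σ.nonempty.choose_spec
    have hcy := (hdiff (σ.vertex 0) (σ.vertex 1) σ.nonempty.choose).choose_spec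
    change _ = (c σ : ℝ) * _ at hcy
    set y := σ.nonempty.choose
    have b : |((n - c σ : ℤ) : ℝ) * (2 * Real.pi)| < 2 * Real.pi := by
      have e : ((n - c σ : ℤ) : ℝ) * (2 * Real.pi) =
          (h (σ.vertex 1) x - h (σ.vertex 0) x) - (h (σ.vertex 1) y - h (σ.vertex 0) y) := by
        rw [hn, hcy]
        push_cast
        ring
      rw [e]
      have := abs_lt.1 (hmem _ x (hx 0))
      have := abs_lt.1 (hmem _ x (hx 1))
      have := abs_lt.1 (hmem _ y (hy 0))
      have := abs_lt.1 (hmem _ y (hy 1))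
      simp only [h]
      rw [abs_lt]
      constructor <;> linarith
    rw [abs_mul, abs_of_pos Real.two_pi_pos] at b
    have b' : |n - c σ| < 1 := by
      have := (mul_lt_iff_lt_one_left Real.two_pi_pos).1 b
      exact_mod_cast this
    rw [hn, sub_eq_zero.1 (Int.abs_lt_one_iff.1 b')]
  have hker : c ∈ (coboundary₁ 𝒰).ker := by
    refine funext fun σ => ?_
    obtain ⟨x, hx⟩ := σ.nonempty
    have e0 := hc (σ.face 0) x fun i => hx _
    have e1 := hc (σ.face 1) x fun i => hx _
    have e2 := hc (σ.face 2) x fun i => hx _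
    change c (σ.face 0) - c (σ.face 1) + c (σ.face 2) = 0
    change h (σ.vertex 2) x - h (σ.vertex 1) x = _ at e0
    change h (σ.vertex 2) x - h (σ.vertex 0) x = _ at e1
    change h (σ.vertex 1) x - h (σ.vertex 0) x = _ at e2
    have : ((c (σ.face 0) - c (σ.face 1) + c (σ.face 2) : ℤ) : ℝ) * (2 * Real.pi) = 0 := by
      push_cast
      linear_combination e1 - e0 - e2
    exact_mod_cast (mul_eq_zero.1 this).resolve_right Real.two_pi_pos.ne'
  refine ⟨_, 𝒰, ⟨c, hker⟩, h, ⟨fun U => ?_, fun U x _ => hexp U x, hc⟩, rfl⟩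
  intro x hx
  have hne : f x / z U ≠ -1 := by
    rintro e
    have := hmem U x hx
    rw [e] at this
    simp [abs_of_pos hpi] at this
    linarith
  exact (continuousAt_const.add ((continuousAt_arg_circle hne).comp (f := fun y => f y / z U)
    (f.continuous.div_const (z U)).continuousAt)).continuousWithinAt

/-- On a compact Hausdorff space every Čech class is represented by a circle-valued function.
For a partition of unity `φ` subordinate to the cover, the functions `-2π ∑ᵥ φᵥ c(U, V)` are
local logarithms with monodromy `c`. -/
theorem exists_represents_class [CompactSpace X] [T2Space X] (ξ : CechH1 X) :
    ∃ f, Represents f ξ := by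
  classical
  obtain ⟨𝒰, c, rfl⟩ := exists_cechClass_eq ξ
  obtain ⟨φ, hφ⟩ := PartitionOfUnity.exists_isSubordinate (s := (Set.univ : Set X)) isClosed_univ
    (fun U : 𝒰.sets => (U.1 : Set X)) (fun U => U.1.isOpen) (fun x _ => by
      obtain ⟨U, hU, hx⟩ := 𝒰.covers x
      exact Set.mem_iUnion.2 ⟨⟨U, hU⟩, hx⟩)
  have hmem : ∀ {V x}, φ V x ≠ 0 → x ∈ V.1 := fun {V x} hx => hφ V (subset_tsupport _ hx)
  -- The cochain `c`, extended by zero to pairs of disjoint members of the cover.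
  let d : 𝒰.sets → 𝒰.sets → ℝ := fun U V =>
    if h : ∃ x : X, ∀ i, x ∈ ((![U, V] : Fin 2 → 𝒰.sets) i).1 then c.1 ⟨![U, V], h⟩ else 0
  have hd : ∀ (σ : NerveSimplex 𝒰 1), d (σ.vertex 0) (σ.vertex 1) = c.1 σ := by
    intro σ
    have hv : ![σ.vertex 0, σ.vertex 1] = σ.vertex := by
      funext i
      fin_cases i <;> rfl
    have hne : ∃ x : X, ∀ i, x ∈ ((![σ.vertex 0, σ.vertex 1] : Fin 2 → 𝒰.sets) i).1 := by
      rw [hv]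
      exact σ.nonempty
    simp only [d]
    rw [dif_pos hne]
    exact congrArg (fun τ => (c.1 τ : ℝ)) (NerveSimplex.ext hv)
  have hcocycle : ∀ (U U' V : 𝒰.sets) x, x ∈ U.1 → x ∈ U'.1 → x ∈ V.1 →
      d U V - d U' V = d U U' := by
    intro U U' V x hx hx' hxV
    have hall : ∀ i, x ∈ ((![U, U', V] : Fin 3 → 𝒰.sets) i).1 := fun i => by
      fin_cases i
      exacts [hx, hx', hxV]
    have e := congrFun (show coboundary₁ 𝒰 c.1 = 0 from c.2) ⟨![U, U', V], x, hall⟩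
    change c.1 _ - c.1 _ + c.1 _ = 0 at e
    have e' := congrArg (Int.cast : ℤ → ℝ) e
    push_cast at e'
    rw [← hd, ← hd, ← hd] at e'
    change d U' V - d U V + d U U' = 0 at e'
    linarith
  let h : 𝒰.sets → X → ℝ := fun U x => -(2 * Real.pi) * ∑ᶠ V, φ V x • d U V
  have hcont : ∀ U, Continuous (h U) := fun U =>
    continuous_const.mul (φ.continuous_finsum_smul fun V _ _ => continuousAt_const)
  have hfin : ∀ x (e : 𝒰.sets → ℝ), (Function.support fun V => φ V x • e V).Finite := fun x e =>
    (φ.locallyFinite.point_finite x).subset fun V hV => by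
      intro h0
      exact hV (by simp [h0])
  have hsub : ∀ (U U' : 𝒰.sets) x, x ∈ U.1 → x ∈ U'.1 →
      h U' x - h U x = d U U' * (2 * Real.pi) := by
    intro U U' x hx hx'
    have e : ∑ᶠ V, φ V x • d U V - ∑ᶠ V, φ V x • d U' V = d U U' := by
      rw [← finsum_sub_distrib (hfin x _) (hfin x _)]
      have : ∀ V, φ V x • d U V - φ V x • d U' V = φ V x * d U U' := by
        intro V
        by_cases h0 : φ V x = 0
        · simp [h0]
        · rw [← smul_sub, hcocycle U U' V x hx hx' (hmem h0), smul_eq_mul]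
      rw [finsum_congr this, ← finsum_mul, φ.sum_eq_one (Set.mem_univ x), one_mul]
    simp only [h]
    rw [← e]
    ring
  have hexp : ∀ (U U' : 𝒰.sets) x, x ∈ U.1 → x ∈ U'.1 →
      Circle.exp (h U' x) = Circle.exp (h U x) := by
    intro U U' x hx hx'
    have hall : ∀ i, x ∈ ((![U, U'] : Fin 2 → 𝒰.sets) i).1 := fun i => by
      fin_cases i
      exacts [hx, hx']
    have e := hsub U U' x hx hx'
    rw [show d U U' = _ from hd ⟨![U, U'], x, hall⟩] at e
    rw [sub_eq_iff_eq_add.1 e, Circle.exp_add, Circle.exp_int_mul_two_pi, one_mul]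
  choose U hU hxU using 𝒰.covers
  refine ⟨⟨fun x => Circle.exp (h ⟨U x, hU x⟩ x), continuous_iff_continuousAt.2 fun x => ?_⟩,
    𝒰, c, h, ⟨fun V => (hcont V).continuousOn, fun V x hx => hexp _ _ x (hxU x) hx,
      fun σ x hx => ?_⟩, rfl⟩
  · refine (Circle.exp.continuous.comp (hcont ⟨U x, hU x⟩)).continuousAt.congr ?_
    filter_upwards [(U x).isOpen.mem_nhds (hxU x)] with y hy
    exact hexp _ _ y (hxU y) hy
  · rw [← hd]
    exact hsub _ _ x (hx 0) (hx 1)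

/-- A circle-valued function avoiding `-1` represents only the zero class. -/
theorem Represents.eq_zero_of_forall_ne {f : C(X, Circle)} {ξ : CechH1 X} (H : Represents f ξ)
    (hf : ∀ x, f x ≠ -1) : ξ = 0 := by
  let h : C(X, ℝ) := ⟨fun x => Complex.arg (f x), continuous_iff_continuousAt.2 fun x =>
    (continuousAt_arg_circle (hf x)).comp f.continuous.continuousAt⟩
  refine Represents.eq_zero (h := h) ?_
  convert H
  ext1 x
  exact Circle.exp_arg (f x)

end Cech

/-! ### The Stone–Čech compactification of the disjoint union and its fibres over ultrafilters -/

section StoneCechFiber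

variable {I : Type*} (X : I → Type*) [∀ i, TopologicalSpace (X i)]

/-- The inclusion of the `i`-th summand into the Stone–Čech compactification of the disjoint
union. -/
noncomputable def summandMap (i : I) : C(X i, StoneCech (Σ i, X i)) where
  toFun x := stoneCechUnit ⟨i, x⟩
  continuous_toFun := continuous_stoneCechUnit.comp continuous_sigmaMk

theorem continuous_pure_sigma_fst :
    Continuous fun y : Σ i, X i => (pure y.1 : Ultrafilter I) :=
  continuous_sigma fun i => (continuous_const : Continuous fun _ : X i => (pure i : Ultrafilter I))

/-- The continuous extension to the Stone–Čech compactification of the map sending a point of the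
`i`-th summand to the principal ultrafilter at `i`. -/
noncomputable def indexUltrafilter : C(StoneCech (Σ i, X i), Ultrafilter I) where
  toFun := stoneCechExtend (continuous_pure_sigma_fst X)
  continuous_toFun := continuous_stoneCechExtend _

variable {X}

theorem indexUltrafilter_summandMap (i : I) (x : X i) :
    indexUltrafilter X (summandMap X i x) = pure i :=
  stoneCechExtend_stoneCechUnit (continuous_pure_sigma_fst X) ⟨i, x⟩

theorem isClopen_mem_indexUltrafilter (S : Set I) :
    IsClopen {z | S ∈ indexUltrafilter X z} :=
  ⟨(ultrafilter_isClosed_basic S).preimage (indexUltrafilter X).continuous,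
    (ultrafilter_isOpen_basic S).preimage (indexUltrafilter X).continuous⟩

theorem isClosed_fiber (𝓤 : Ultrafilter I) :
    IsClosed {z : StoneCech (Σ i, X i) | indexUltrafilter X z = 𝓤} :=
  isClosed_singleton.preimage (indexUltrafilter X).continuous

/-- The sets `{z | S ∈ indexUltrafilter X z}`, for `S ∈ 𝓤`, form a neighbourhood basis of the
fibre over `𝓤`. -/
theorem exists_mem_indexUltrafilter_subset {𝓤 : Ultrafilter I} {N : Set (StoneCech (Σ i, X i))}
    (hN : IsOpen N) (h : ∀ z, indexUltrafilter X z = 𝓤 → z ∈ N) :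
    ∃ S ∈ 𝓤, ∀ z, S ∈ indexUltrafilter X z → z ∈ N := by
  have hclosed : IsClosed (indexUltrafilter X '' Nᶜ) :=
    (hN.isClosed_compl.isCompact.image (indexUltrafilter X).continuous).isClosed
  have hmem : 𝓤 ∈ (indexUltrafilter X '' Nᶜ)ᶜ := by
    rintro ⟨z, hz, e⟩
    exact hz (h z e)
  obtain ⟨_, ⟨S, rfl⟩, hS, hsub⟩ :=
    ultrafilterBasis_is_basis.exists_subset_of_mem_open hmem hclosed.isOpen_compl
  refine ⟨S, hS, fun z hz => ?_⟩
  by_contra hzN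
  exact hsub hz ⟨z, hzN, rfl⟩

theorem exists_summandMap_mem {N : Set (StoneCech (Σ i, X i))} (hN : IsOpen N)
    (h : N.Nonempty) : ∃ i x, summandMap X i x ∈ N := by
  obtain ⟨_, hy, ⟨⟨i, x⟩, rfl⟩⟩ := denseRange_stoneCechUnit.inter_open_nonempty N hN h
  exact ⟨i, x, hy⟩

theorem exists_extension_of_summands {T : Type*} [TopologicalSpace T] [CompactSpace T] [T2Space T]
    (u : ∀ i, C(X i, T)) :
    ∃ G : C(StoneCech (Σ i, X i), T), ∀ i, G.comp (summandMap X i) = u i :=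
  ⟨⟨stoneCechExtend (ContinuousMap.sigma u).continuous, continuous_stoneCechExtend _⟩,
    fun _ => ContinuousMap.ext fun _ =>
      stoneCechExtend_stoneCechUnit (ContinuousMap.sigma u).continuous _⟩

theorem continuous_piecewise_of_isClopen {Z T : Type*} [TopologicalSpace Z] [TopologicalSpace T]
    {C : Set Z} [∀ z, Decidable (z ∈ C)] (hC : IsClopen C) {f g : Z → T} (hf : Continuous f)
    (hg : Continuous g) : Continuous (C.piecewise f g) :=
  hf.piecewise (by simp [hC.frontier_eq]) hg

/-! ### The ultracoproduct as a fibre -/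

variable [∀ i, CompactSpace (X i)]

variable (X) in
/-- Restriction of continuous functions on the Stone–Čech compactification to the summands. -/
noncomputable def restrictFamilies : C(StoneCech (Σ i, X i), ℂ) →ₐ[ℂ] boundedFamilies X where
  toFun f := ⟨fun i => f.comp (summandMap X i), ‖f‖, fun _ =>
    (ContinuousMap.norm_le _ (norm_nonneg f)).2 fun _ => f.norm_coe_le_norm _⟩
  map_one' := rfl
  map_mul' _ _ := rfl
  map_zero' := rfl
  map_add' _ _ := rfl
  commutes' _ := rfl

theorem restrictFamilies_bijective : Function.Bijective (restrictFamilies X) := by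
  constructor
  · intro f g h
    refine DFunLike.coe_injective (stoneCech_hom_ext f.continuous g.continuous ?_)
    funext ⟨i, x⟩
    exact DFunLike.congr_fun (congrFun (congrArg Subtype.val h) i) x
  · rintro ⟨b, K, hK⟩
    have : CompactSpace (Metric.closedBall (0 : ℂ) K) :=
      isCompact_iff_compactSpace.1 (isCompact_closedBall 0 K)
    obtain ⟨G, hG⟩ := exists_extension_of_summands (T := Metric.closedBall (0 : ℂ) K) fun i =>
      ⟨fun x => ⟨b i x, mem_closedBall_zero_iff.2 (((b i).norm_coe_le_norm x).trans (hK i))⟩,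
        (b i).continuous.subtype_mk _⟩
    refine ⟨⟨fun z => (G z : ℂ), continuous_subtype_val.comp G.continuous⟩, Subtype.ext ?_⟩
    funext i
    ext x
    exact congrArg Subtype.val (DFunLike.congr_fun (hG i) x)

/-- A point lies in the fibre over `𝓤` exactly if it annihilates the null families. -/
theorem indexUltrafilter_eq_iff {𝓤 : Ultrafilter I} {z : StoneCech (Σ i, X i)} :
    indexUltrafilter X z = 𝓤 ↔
      ∀ f : C(StoneCech (Σ i, X i), ℂ), restrictFamilies X f ∈ nullFamilies 𝓤 X → f z = 0 := by
  classical
  constructor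
  · rintro rfl f hf
    by_contra hz
    have hpos : 0 < ‖f z‖ / 2 := half_pos (norm_pos_iff.2 hz)
    have hS : {i | ‖f.comp (summandMap X i)‖ < ‖f z‖ / 2} ∈ indexUltrafilter X z :=
      (show Tendsto _ _ _ from hf).eventually_lt_const hpos
    obtain ⟨i, x, hx, hi⟩ := exists_summandMap_mem
      ((isOpen_lt continuous_const (by fun_prop : Continuous fun w => ‖f w‖)).inter
        (isClopen_mem_indexUltrafilter _).isOpen)
      ⟨z, (half_lt_self (norm_pos_iff.2 hz) : ‖f z‖ / 2 < ‖f z‖), hS⟩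
    rw [Set.mem_ofPred, indexUltrafilter_summandMap] at hi
    exact lt_irrefl _ (hi.trans (lt_of_lt_of_le hx
      ((f.comp (summandMap X i)).norm_coe_le_norm x)))
  · intro h
    by_contra hne
    obtain ⟨S, hS, hSz⟩ : ∃ S ∈ 𝓤, S ∉ indexUltrafilter X z := by
      by_contra! H
      exact hne (Ultrafilter.coe_le_coe.1 fun S hS => H S hS)
    -- The indicator function of the clopen set of points whose index ultrafilter omits `S`.
    have hcont : Continuous ({z | S ∈ indexUltrafilter X z}.piecewise
        (fun _ => (0 : ℂ)) fun _ => 1) :=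
      continuous_piecewise_of_isClopen (isClopen_mem_indexUltrafilter S) continuous_const
        continuous_const
    have h1 := h ⟨_, hcont⟩ (by
      refine tendsto_const_nhds.congr' ?_
      filter_upwards [hS] with i hi
      refine (norm_eq_zero.2 (ContinuousMap.ext fun x => ?_)).symm
      have hmem : summandMap X i x ∈ {z | S ∈ indexUltrafilter X z} := by
        rw [Set.mem_ofPred, indexUltrafilter_summandMap]
        exact hi
      exact Set.piecewise_eq_of_mem _ (fun _ => (0 : ℂ)) (fun _ => 1) hmem)
    have hz : z ∉ {z | S ∈ indexUltrafilter X z} := hSz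
    exact one_ne_zero ((Set.piecewise_eq_of_notMem _ (fun _ => (0 : ℂ)) (fun _ => 1) hz).symm.trans h1)

instance (𝓤 : Ultrafilter I) : T2Space (Ultracoproduct 𝓤 X) :=
  T2Space.of_injective_continuous
    (f := fun φ : FunctionUltraproduct 𝓤 X →ₐ[ℂ] ℂ => (φ : FunctionUltraproduct 𝓤 X → ℂ))
    (DFunLike.coe_injective (F := FunctionUltraproduct 𝓤 X →ₐ[ℂ] ℂ)) continuous_induced_dom

variable (X) in
/-- The character of the ultraproduct given by evaluation at a point of the fibre over `𝓤`. -/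
noncomputable def fiberCharacter (𝓤 : Ultrafilter I)
    (z : {z : StoneCech (Σ i, X i) // indexUltrafilter X z = 𝓤}) : Ultracoproduct 𝓤 X :=
  show FunctionUltraproduct 𝓤 X →ₐ[ℂ] ℂ from Ideal.Quotient.liftₐ (nullFamilies 𝓤 X)
    ((ContinuousMap.evalAlgHom ℂ ℂ z.1).comp
      (AlgEquiv.ofBijective (restrictFamilies X) restrictFamilies_bijective).symm.toAlgHom)
    (by
      intro b hb
      obtain ⟨f, rfl⟩ := restrictFamilies_bijective.2 b
      have := indexUltrafilter_eq_iff.1 z.2 f hb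
      simpa using! this)

theorem fiberCharacter_apply (𝓤 : Ultrafilter I)
    (z : {z : StoneCech (Σ i, X i) // indexUltrafilter X z = 𝓤})
    (f : C(StoneCech (Σ i, X i), ℂ)) :
    (show FunctionUltraproduct 𝓤 X →ₐ[ℂ] ℂ from fiberCharacter X 𝓤 z)
      (Ideal.Quotient.mk _ (restrictFamilies X f)) = f z.1 := by
  change (AlgEquiv.ofBijective (restrictFamilies X) restrictFamilies_bijective).symm
    (restrictFamilies X f) z.1 = f z.1
  congr 1
  exact (AlgEquiv.ofBijective (restrictFamilies X) restrictFamilies_bijective).symm_apply_apply f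

theorem continuous_fiberCharacter (𝓤 : Ultrafilter I) : Continuous (fiberCharacter X 𝓤) := by
  refine continuous_induced_rng.2 (continuous_pi fun a => ?_)
  obtain ⟨b, rfl⟩ := Ideal.Quotient.mk_surjective a
  obtain ⟨f, rfl⟩ := restrictFamilies_bijective.2 b
  exact (f.continuous.comp continuous_subtype_val).congr fun z =>
    (fiberCharacter_apply 𝓤 z f).symm

/-- Every character comes from the fibre: composed with restriction it becomes a character of the
algebra of continuous functions on a compact Hausdorff space, that is, a point evaluation. -/
theorem fiberCharacter_bijective (𝓤 : Ultrafilter I) :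
    Function.Bijective (fiberCharacter X 𝓤) := by
  have hbij := WeakDual.CharacterSpace.continuousMapEval_bijective (StoneCech (Σ i, X i)) ℂ
  constructor
  · intro z z' h
    refine Subtype.ext (hbij.1 (WeakDual.CharacterSpace.ext fun f => ?_))
    change f z.1 = f z'.1
    rw [← fiberCharacter_apply 𝓤 z f, ← fiberCharacter_apply 𝓤 z' f, h]
  · intro (φ : FunctionUltraproduct 𝓤 X →ₐ[ℂ] ℂ)
    obtain ⟨z, hz⟩ := hbij.2 (WeakDual.CharacterSpace.equivAlgHom.symm
      ((φ.comp (Ideal.Quotient.mkₐ ℂ (nullFamilies 𝓤 X))).comp (restrictFamilies X)))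
    have hzf : ∀ f : C(StoneCech (Σ i, X i), ℂ),
        f z = φ (Ideal.Quotient.mk _ (restrictFamilies X f)) := fun f => DFunLike.congr_fun hz f
    refine ⟨⟨z, indexUltrafilter_eq_iff.2 fun f hf => ?_⟩, ?_⟩
    · rw [hzf, Ideal.Quotient.eq_zero_iff_mem.2 hf, map_zero]
    · refine AlgHom.ext fun a => ?_
      obtain ⟨b, rfl⟩ := Ideal.Quotient.mk_surjective a
      obtain ⟨f, rfl⟩ := restrictFamilies_bijective.2 b
      exact (fiberCharacter_apply 𝓤 _ f).trans (hzf f)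

variable (X) in
/-- The ultracoproduct is homeomorphic to the fibre over `𝓤` of the Stone–Čech compactification
of the disjoint union. -/
noncomputable def fiberHomeomorph (𝓤 : Ultrafilter I) :
    {z : StoneCech (Σ i, X i) // indexUltrafilter X z = 𝓤} ≃ₜ Ultracoproduct 𝓤 X :=
  have : CompactSpace {z : StoneCech (Σ i, X i) // indexUltrafilter X z = 𝓤} :=
    isCompact_iff_compactSpace.1 (isClosed_fiber 𝓤).isCompact
  Continuous.homeoOfEquivCompactToT2 (f := Equiv.ofBijective _ (fiberCharacter_bijective 𝓤))
    (continuous_fiberCharacter 𝓤)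

instance (𝓤 : Ultrafilter I) : CompactSpace (Ultracoproduct 𝓤 X) :=
  have : CompactSpace {z : StoneCech (Σ i, X i) // indexUltrafilter X z = 𝓤} :=
    isCompact_iff_compactSpace.1 (isClosed_fiber 𝓤).isCompact
  (fiberHomeomorph X 𝓤).compactSpace

variable (X) in
/-- The embedding of the ultracoproduct into the Stone–Čech compactification. -/
noncomputable def ultracoproductMap (𝓤 : Ultrafilter I) :
    C(Ultracoproduct 𝓤 X, StoneCech (Σ i, X i)) where
  toFun φ := ((fiberHomeomorph X 𝓤).symm φ).1
  continuous_toFun := continuous_subtype_val.comp (fiberHomeomorph X 𝓤).symm.continuous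

theorem isClosedEmbedding_ultracoproductMap (𝓤 : Ultrafilter I) :
    Topology.IsClosedEmbedding (ultracoproductMap X 𝓤) :=
  (isClosed_fiber 𝓤).isClosedEmbedding_subtypeVal.comp (fiberHomeomorph X 𝓤).symm.isClosedEmbedding

/-- Every neighbourhood of the ultracoproduct contains a clopen neighbourhood of the form
`{z | S ∈ indexUltrafilter X z}` with `S ∈ 𝓤`. -/
theorem exists_mem_of_ultracoproductMap_mem {𝓤 : Ultrafilter I} {N : Set (StoneCech (Σ i, X i))}
    (hN : IsOpen N) (h : ∀ φ, ultracoproductMap X 𝓤 φ ∈ N) :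
    ∃ S ∈ 𝓤, ∀ z, S ∈ indexUltrafilter X z → z ∈ N := by
  refine exists_mem_indexUltrafilter_subset hN fun z hz => ?_
  have := h (fiberHomeomorph X 𝓤 ⟨z, hz⟩)
  simpa [ultracoproductMap] using this

theorem mem_indexUltrafilter_ultracoproductMap {𝓤 : Ultrafilter I} {S : Set I} (hS : S ∈ 𝓤)
    (φ : Ultracoproduct 𝓤 X) : S ∈ indexUltrafilter X (ultracoproductMap X 𝓤 φ) := by
  have := ((fiberHomeomorph X 𝓤).symm φ).2
  rw [← this] at hS
  exact hS

/-! ### Circle-valued functions on the ultracoproduct -/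

/-- Circle-valued functions extend from the ultracoproduct: a complex-valued extension has no
zeros near the ultracoproduct, so it can be normalized there, and replaced by `1` elsewhere. -/
theorem exists_circle_extension {𝓤 : Ultrafilter I} (f : C(Ultracoproduct 𝓤 X, Circle)) :
    ∃ G : C(StoneCech (Σ i, X i), Circle), G.comp (ultracoproductMap X 𝓤) = f := by
  classical
  obtain ⟨F, hF⟩ := ContinuousMap.exists_extension (isClosedEmbedding_ultracoproductMap 𝓤)
    (⟨fun φ => (f φ : ℂ), continuous_subtype_val.comp f.continuous⟩ : C(Ultracoproduct 𝓤 X, ℂ))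
  have hFφ : ∀ φ, F (ultracoproductMap X 𝓤 φ) = f φ := fun φ => DFunLike.congr_fun hF φ
  obtain ⟨S, hS, hne⟩ := exists_mem_of_ultracoproductMap_mem (𝓤 := 𝓤)
    (isOpen_ne_fun F.continuous continuous_const : IsOpen {z | F z ≠ 0})
    (fun φ => by simp [hFφ])
  set C := {z | S ∈ indexUltrafilter X z}
  set F' := C.piecewise F fun _ => 1 with hF'
  have hcont : Continuous F' := continuous_piecewise_of_isClopen (isClopen_mem_indexUltrafilter S)
    F.continuous continuous_const
  have hF0 : ∀ z, F' z ≠ 0 := fun z => by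
    by_cases hz : z ∈ C
    · rw [hF', Set.piecewise_eq_of_mem _ _ _ hz]
      exact hne z hz
    · rw [hF', Set.piecewise_eq_of_notMem _ _ _ hz]
      exact one_ne_zero
  refine ⟨⟨fun z => ⟨F' z / ‖F' z‖, by simp [Submonoid.unitSphere, hF0]⟩, ?_⟩, ?_⟩
  · refine Continuous.subtype_mk (hcont.div (by fun_prop) fun z => ?_) _
    simp [hF0]
  · ext φ
    have hφ : ultracoproductMap X 𝓤 φ ∈ C := mem_indexUltrafilter_ultracoproductMap hS φ
    have e : F' (ultracoproductMap X 𝓤 φ) = f φ :=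
      (Set.piecewise_eq_of_mem _ _ _ hφ).trans (hFφ φ)
    change F' (ultracoproductMap X 𝓤 φ) / ‖F' (ultracoproductMap X 𝓤 φ)‖ = f φ
    rw [e, Circle.norm_coe, Complex.ofReal_one, div_one]

open Cech in
/-- If the restriction of `G` to the ultracoproduct represents the zero class, then so do almost
all restrictions of `G` to the summands: an extension of a global logarithm on the ultracoproduct
is, on almost all summands, a logarithm of `G` up to a factor that avoids `-1`. -/
theorem eventually_eq_zero_of_represents {𝓤 : Ultrafilter I}
    {G : C(StoneCech (Σ i, X i), Circle)}
    (hG : Represents (G.comp (ultracoproductMap X 𝓤)) 0) {η : ∀ i, CechH1 (X i)}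
    (hη : ∀ i, Represents (G.comp (summandMap X i)) (η i)) :
    ∀ᶠ i in (𝓤 : Filter I), η i = 0 := by
  obtain ⟨h, hh⟩ := hG.exists_eq_exp
  obtain ⟨H, rfl⟩ := ContinuousMap.exists_extension (isClosedEmbedding_ultracoproductMap 𝓤) h
  obtain ⟨S, hS, hne⟩ := exists_mem_of_ultracoproductMap_mem (𝓤 := 𝓤)
    (isOpen_ne_fun (G / Circle.exp.comp H).continuous continuous_const :
      IsOpen {z | (G / Circle.exp.comp H) z ≠ -1})
    (fun φ => by
      have e : G (ultracoproductMap X 𝓤 φ) = Circle.exp (H (ultracoproductMap X 𝓤 φ)) :=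
        DFunLike.congr_fun hh φ
      change G _ / Circle.exp _ ≠ -1
      rw [e, div_self']
      exact fun h1 => Circle.neg_ne_self 1 h1.symm)
  filter_upwards [hS] with i hi
  obtain ⟨ζ, hζ⟩ := exists_represents (Circle.exp.comp (H.comp (summandMap X i)))
  have h0 := hζ.eq_zero
  have hquot := ((hη i).div hζ).eq_zero_of_forall_ne fun x => hne (summandMap X i x) (by
    rw [indexUltrafilter_summandMap]
    exact hi)
  rw [sub_eq_zero.1 hquot, h0]

end StoneCechFiber

theorem proposition4p10 {I : Type*} (𝓤 : Ultrafilter I) (X : I → Type*)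
    [∀ i, TopologicalSpace (X i)] [∀ i, CompactSpace (X i)] [∀ i, T2Space (X i)] :
    ∃ q : Cech.CechH1 (Ultracoproduct 𝓤 X) →+
        GroupUltraproduct 𝓤 (fun i => Cech.CechH1 (X i)),
      Function.Surjective q := by
  let π : (∀ i, Cech.CechH1 (X i)) →+ GroupUltraproduct 𝓤 (fun i => Cech.CechH1 (X i)) :=
    QuotientAddGroup.mk' (eventuallyZero 𝓤 fun i => Cech.CechH1 (X i))
  have hπ : Function.Surjective π := QuotientAddGroup.mk'_surjective _
  refine exists_surjective_addMonoidHom_of_relation (fun ξ η =>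
    ∃ G : C(StoneCech (Σ i, X i), Circle), Cech.Represents (G.comp (ultracoproductMap X 𝓤)) ξ ∧
      ∃ η' : ∀ i, Cech.CechH1 (X i),
        (∀ i, Cech.Represents (G.comp (summandMap X i)) (η' i)) ∧ π η' = η) ?_ ?_ ?_ ?_
  · rintro ξ₁ ξ₂ _ _ ⟨G₁, h₁, η₁, k₁, rfl⟩ ⟨G₂, h₂, η₂, k₂, rfl⟩
    refine ⟨G₁ / G₂, ?_, η₁ - η₂, fun i => ?_, map_sub π _ _⟩
    · rw [ContinuousMap.div_comp]
      exact h₁.div h₂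
    · rw [ContinuousMap.div_comp]
      exact (k₁ i).div (k₂ i)
  · intro ξ
    obtain ⟨f, hf⟩ := Cech.exists_represents_class ξ
    obtain ⟨G, rfl⟩ := exists_circle_extension f
    choose η' hη' using fun i => Cech.exists_represents (G.comp (summandMap X i))
    exact ⟨π η', G, hf, η', hη', rfl⟩
  · intro η
    obtain ⟨η', rfl⟩ := hπ η
    choose u hu using fun i => Cech.exists_represents_class (η' i)
    obtain ⟨G, hG⟩ := exists_extension_of_summands u
    obtain ⟨ξ, hξ⟩ := Cech.exists_represents (G.comp (ultracoproductMap X 𝓤))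
    exact ⟨ξ, G, hξ, η', fun i => by rw [hG]; exact hu i, rfl⟩
  · rintro _ ⟨G, hG, η', hη', rfl⟩
    exact (QuotientAddGroup.eq_zero_iff _).2 (eventually_eq_zero_of_represents hG hη')
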